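/- Let $\Gamma$ be a graph with vertex set $V=\{a_i\}$ such that: $\Gamma$ has no induced squares (induced $4$-cycles); $\Gamma$ is not complete; and $\Gamma$ has no separating clique, i.e. $\Gamma\setminus K$ is connected for every (possibly empty) complete subgraph $K$. Let $W_\Gamma=\langle V\mid a_i^2\ (a_i\in V),\ [a_i,a_j]\ (a_i,a_j \text{ adjacent})\rangle$ be the associated right-angled Coxeter group, with word metric $d(g,h)=|g^{-1}h|$ with respect to $V$, and fix a linear order on $V$. Let $a_i\neq a_j$ be non-adjacent vertices and let $\gamma=(a_ia_j)^\infty$ be the geodesic ray $e, a_i, a_ia_j, a_ia_ja_i,\dots$. Let $b_\gamma(w)=\lim_{n\to\infty}\bigl(d(\gamma(n),w)-d(\gamma(n),e)\bigr)$ be its Busemann function; the horospheres are the sets $b_\gamma^{-1}(k)$, $k\in\mathbb Z$. The $2$-Rips graph on a horosphere has the points of the horosphere as vertices, and two distinct points are joined by an edge if and only if their distance $d$ is at most $2$. A word is shortlex if it is geodesic and alphabetically first among the geodesic words representing the same element. A prefix-suffix decomposition of a shortlex word $w$ consists of words $w_{pref}$ and $w_{suff}$ such that $w_{pref}w_{suff}$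 is a geodesic word representing the same element as $w$, the word $w_{pref}$ uses only the letters $a_i,a_j$, and $w_{suff}$ is shortlex and cannot be rearranged, by swapping consecutive letters that are adjacent in $\Gamma$, to begin with $a_i$ or $a_j$. An element has empty suffix if its shortlex word has such a decomposition with $w_{suff}$ empty. Then: 1. For every $k\in\mathbb Z$ the horosphere $b_\gamma^{-1}(k)$ contains exactly one element with empty suffix. Moreover, for every $w\in W_\Gamma$, if $v$ is the element with empty suffix in the horosphere $b_\gamma^{-1}(b_\gamma(w))$, then there is a path from $v$ to $w$ in the $2$-Rips graph on this horosphere. 2. Consequently, for every $k\in\mathbb Z$, the $2$-Rips graph on the horosphere $b_\gamma^{-1}(k)$ is connected (and non-empty). -/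

import Mathlib

open Filter Topology

noncomputable section

/-! ### Right-angled Coxeter groups and their word metric -/

section RACG

variable {V : Type*}

open Classical in
/-- The Coxeter matrix of a right-angled Coxeter group: two generators commute if they span an
edge of `Γ`, and are otherwise unrelated (in Mathlib, an entry `0` stands for `∞`). -/
def racgMatrix (Γ : SimpleGraph V) : CoxeterMatrix V where
  M := Matrix.of fun u v => if u = v then 1 else if Γ.Adj u v then 2 else 0
  isSymm := by
    ext u v
    simp [Matrix.transpose_apply, eq_comm, Γ.adj_comm]
  diagonal := by simp
  off_diagonal := by
    intro u v huv
    simp only [Matrix.of_apply, if_neg huv]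
    split_ifs <;> decide

/-- The right-angled Coxeter group `W_Γ`: generators the vertices of `Γ`, every generator has
square `1`, and adjacent vertices commute (given `u ^ 2 = v ^ 2 = 1`, the relator `(u * v) ^ 2`
says that `u` and `v` commute). -/
def RACG (Γ : SimpleGraph V) : Type _ := (racgMatrix Γ).Group

variable (Γ : SimpleGraph V)

instance : Group (RACG Γ) := inferInstanceAs (Group (racgMatrix Γ).Group)

/-- The standard Coxeter system, with generating set the vertex set of `Γ`. -/
def racgSystem : CoxeterSystem (racgMatrix Γ) (RACG Γ) := (racgMatrix Γ).toCoxeterSystem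

/-- The generator of `W_Γ` that belongs to a vertex. -/
abbrev racgGen (v : V) : RACG Γ := (racgSystem Γ).simple v

/-- The element of `W_Γ` spelled by a word in the vertices. -/
abbrev spell (l : List V) : RACG Γ := (racgSystem Γ).wordProd l

variable {Γ}

/-- `|w|`: the least length of a word in the generators that spells `w`. -/
abbrev wordLength (w : RACG Γ) : ℕ := (racgSystem Γ).length w

/-- The word metric `d(g, h) = |g⁻¹ h|`, that is, the path metric of the Cayley graph. -/
def wordDist (g h : RACG Γ) : ℕ := wordLength (g⁻¹ * h)

theorem wordDist_self (g : RACG Γ) : wordDist g g = 0 := by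
  simp [wordDist, wordLength]

theorem wordDist_comm (g h : RACG Γ) : wordDist g h = wordDist h g := by
  unfold wordDist wordLength
  rw [← (racgSystem Γ).length_inv (g⁻¹ * h)]
  simp

theorem wordDist_triangle (g h k : RACG Γ) : wordDist g k ≤ wordDist g h + wordDist h k := by
  unfold wordDist wordLength
  have := (racgSystem Γ).length_mul_le (g⁻¹ * h) (h⁻¹ * k)
  simpa [mul_assoc] using this

theorem eq_of_wordDist_eq_zero {g h : RACG Γ} (hgh : wordDist g h = 0) : g = h := by
  unfold wordDist wordLength at hgh
  rw [CoxeterSystem.length_eq_zero_iff] at hgh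
  exact inv_mul_eq_one.mp hgh

instance : MetricSpace (RACG Γ) where
  dist g h := (wordDist g h : ℝ)
  dist_self g := by simp [wordDist_self]
  dist_comm g h := by simp [wordDist_comm g h]
  dist_triangle g h k := by exact_mod_cast wordDist_triangle g h k
  eq_of_dist_eq_zero := by
    intro g h hgh
    exact eq_of_wordDist_eq_zero (by exact_mod_cast hgh)

theorem dist_eq_wordDist (g h : RACG Γ) : dist g h = (wordDist g h : ℝ) := rfl

end RACG

/-! ### The assumptions on the defining graph -/

/-- No induced squares, not complete, and no separating (possibly empty) cliques. -/
structure StandingAssumptions {V : Type*} (Γ : SimpleGraph V) : Prop where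
  no_induced_square : IsEmpty (SimpleGraph.cycleGraph 4 ↪g Γ)
  not_complete : Γ ≠ ⊤
  no_separating_clique : ∀ K : Set V, Γ.IsClique K → (Γ.induce Kᶜ).Preconnected

/-! ### Rays, Busemann functions, horospheres -/

section Busemann

variable {V : Type*} {Γ : SimpleGraph V}

/-- A geodesic ray, as a sequence of group elements. -/
def IsGeodesicRay (γ : ℕ → RACG Γ) : Prop :=
  ∀ m n : ℕ, m ≤ n → wordDist (γ m) (γ n) = n - m

/-- The Busemann function `b_γ(w) = lim_n (d(γ(n), w) - d(γ(n), e))`. The limit exists for every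
geodesic ray, see `tendsto_busemann`. -/
def busemann (γ : ℕ → RACG Γ) (w : RACG Γ) : ℤ :=
  limUnder atTop fun n : ℕ => (wordDist (γ n) w : ℤ) - (wordDist (γ n) 1 : ℤ)

/-- The `k`-horosphere `b_γ⁻¹(k)`. -/
def horosphere (γ : ℕ → RACG Γ) (k : ℤ) : Set (RACG Γ) := {w | busemann γ w = k}

variable (Γ) in
/-- The ray `(a_i a_j)^∞`: its points are `e, a_i, a_i a_j, a_i a_j a_i, …`. -/
def alternatingRay (i j : V) : ℕ → RACG Γ
  | 0 => 1
  | n + 1 => alternatingRay i j n * racgGen Γ (if Even n then i else j)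

theorem tendsto_busemann {γ : ℕ → RACG Γ} (hγ : IsGeodesicRay γ) (w : RACG Γ) :
    Tendsto (fun n : ℕ => (wordDist (γ n) w : ℤ) - (wordDist (γ n) 1 : ℤ)) atTop
      (𝓝 (busemann γ w)) := by
  apply tendsto_nhds_limUnder
  -- up to an eventually constant error the sequence is antitone, and it is bounded below
  have key : ∀ u : RACG Γ, ∃ c : ℤ, ∀ᶠ n : ℕ in atTop, (wordDist (γ n) u : ℤ) - n = c := by
    intro u
    have anti : Antitone fun n : ℕ => (wordDist (γ n) u : ℤ) - n := by
      apply antitone_nat_of_succ_le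
      intro n
      have h1 := wordDist_triangle (γ (n + 1)) (γ n) u
      have h2 := hγ n (n + 1) (Nat.le_succ n)
      rw [wordDist_comm] at h2
      push_cast
      omega
    have bdd : ∀ n : ℕ, -(wordDist (γ 0) u : ℤ) ≤ (wordDist (γ n) u : ℤ) - n := by
      intro n
      have h1 := wordDist_triangle (γ 0) u (γ n)
      have h2 := hγ 0 n (Nat.zero_le n)
      rw [wordDist_comm u] at h1
      omega
    obtain ⟨c, ⟨N, hN⟩, hmin⟩ := Int.exists_least_of_bdd
      (P := fun z => ∃ n : ℕ, (wordDist (γ n) u : ℤ) - n = z)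
      ⟨_, by rintro z ⟨n, rfl⟩; exact bdd n⟩ ⟨_, 0, rfl⟩
    refine ⟨c, eventually_atTop.mpr ⟨N, fun n hn => le_antisymm ?_ (hmin _ ⟨n, rfl⟩)⟩⟩
    exact hN ▸ anti hn
  obtain ⟨c, hc⟩ := key w
  obtain ⟨c', hc'⟩ := key 1
  refine ⟨c - c', tendsto_const_nhds.congr' ?_⟩
  filter_upwards [hc, hc'] with n h h'
  omega

open Classical in
/-- An action of `W_Γ` on the integers that detects the length of alternating words. -/
theorem exists_lineAction {i j : V} (hij : i ≠ j) (hadj : ¬ Γ.Adj i j) :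
    ∃ φ : RACG Γ →* Equiv.Perm ℤ, (∀ x, φ (racgGen Γ i) x = 1 - x) ∧
      (∀ x, φ (racgGen Γ j) x = -1 - x) ∧ ∀ v, v ≠ i → v ≠ j → φ (racgGen Γ v) = 1 := by
  let f : V → Equiv.Perm ℤ := fun v =>
    if v = i then Equiv.subLeft 1 else if v = j then Equiv.subLeft (-1) else 1
  have sq : ∀ v, f v * f v = 1 := by
    intro v
    ext x
    simp only [f]
    split_ifs <;> simp
  have hf : (racgMatrix Γ).IsLiftable f := by
    intro u v
    by_cases huv : u = v
    · subst huv
      simp [sq]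
    by_cases ha : Γ.Adj u v
    · have hM : (racgMatrix Γ).M u v = 2 := by simp [racgMatrix, huv, ha]
      have : f u = 1 ∨ f v = 1 := by
        by_contra hcon
        push Not at hcon
        have hu : u = i ∨ u = j := by
          by_contra h
          push Not at h
          exact hcon.1 (by simp [f, h.1, h.2])
        have hv : v = i ∨ v = j := by
          by_contra h
          push Not at h
          exact hcon.2 (by simp [f, h.1, h.2])
        rcases hu with rfl | rfl <;> rcases hv with rfl | rfl
        · exact huv rfl
        · exact hadj ha
        · exact hadj ha.symm
        · exact huv rfl
      rw [hM, pow_two]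
      rcases this with h | h <;> simp [h, sq]
    · have hM : (racgMatrix Γ).M u v = 0 := by simp [racgMatrix, huv, ha]
      rw [hM, pow_zero]
  refine ⟨(racgSystem Γ).lift ⟨f, hf⟩, ?_, ?_, ?_⟩
  · intro x
    rw [racgGen, CoxeterSystem.lift_apply_simple]
    simp [f]
  · intro x
    rw [racgGen, CoxeterSystem.lift_apply_simple]
    simp [f, hij.symm]
  · intro v hvi hvj
    rw [racgGen, CoxeterSystem.lift_apply_simple]
    simp [f, hvi, hvj]

theorem isGeodesicRay_alternatingRay {i j : V} (hij : i ≠ j) (hadj : ¬ Γ.Adj i j) :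
    IsGeodesicRay (alternatingRay Γ i j) := by
  obtain ⟨φ, hi, hj, hv⟩ := exists_lineAction hij hadj
  have gen : ∀ v : V, (∀ x y, |φ (racgGen Γ v) x - φ (racgGen Γ v) y| = |x - y|) ∧
      |φ (racgGen Γ v) 0| ≤ 1 := by
    intro v
    by_cases h1 : v = i
    · subst h1
      refine ⟨fun x y => ?_, by simp [hi]⟩
      rw [hi, hi, show (1 - x) - (1 - y) = -(x - y) by ring, abs_neg]
    by_cases h2 : v = j
    · subst h2
      refine ⟨fun x y => ?_, by simp [hj]⟩
      rw [hj, hj, show (-1 - x) - (-1 - y) = -(x - y) by ring, abs_neg]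
    simp [hv v h1 h2]
  have word : ∀ l : List V, (∀ x y, |φ (spell Γ l) x - φ (spell Γ l) y| = |x - y|) ∧
      |φ (spell Γ l) 0| ≤ l.length := by
    intro l
    induction l with
    | nil => simp [spell]
    | cons v l ih =>
      rw [spell, CoxeterSystem.wordProd_cons, map_mul]
      refine ⟨fun x y => ?_, ?_⟩
      · rw [Equiv.Perm.mul_apply, Equiv.Perm.mul_apply, (gen v).1, ih.1]
      · rw [Equiv.Perm.mul_apply]
        have h1 := (gen v).1 (φ (spell Γ l) 0) 0
        have h2 := (gen v).2
        have h3 := ih.2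
        have h4 := abs_sub_abs_le_abs_sub (φ (racgGen Γ v) (φ (spell Γ l) 0)) (φ (racgGen Γ v) 0)
        simp only [sub_zero] at h1
        rw [List.length_cons, Nat.cast_succ]
        exact (by linarith : |φ (racgGen Γ v) (φ (spell Γ l) 0)| ≤ (l.length : ℤ) + 1)
  have elt : ∀ g : RACG Γ, (∀ x y, |φ g x - φ g y| = |x - y|) ∧ |φ g 0| ≤ wordLength g := by
    intro g
    obtain ⟨l, hl, rfl⟩ := (racgSystem Γ).exists_isReduced g
    refine ⟨(word l).1, ?_⟩
    rw [wordLength, hl.eq]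
    exact (word l).2
  have lower : ∀ g h : RACG Γ, |φ g 0 - φ h 0| ≤ wordDist g h := by
    intro g h
    have h1 := (elt g).1 0 (φ (g⁻¹ * h) 0)
    have h2 := (elt (g⁻¹ * h)).2
    rw [← Equiv.Perm.mul_apply, ← map_mul, mul_inv_cancel_left, zero_sub, abs_neg] at h1
    rw [h1]
    exact h2
  have step : ∀ n x, φ (alternatingRay Γ i j n) x = n + (if Even n then x else -x) := by
    intro n
    induction n with
    | zero => simp [alternatingRay]
    | succ n ih =>
      intro x
      rw [alternatingRay, map_mul, Equiv.Perm.mul_apply, ih]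
      by_cases hn : Even n
      · simp only [hn, if_true, hi, Nat.even_add_one, not_true_eq_false, if_false]
        push_cast
        ring
      · simp only [hn, if_false, hj, Nat.even_add_one, not_false_eq_true, if_true]
        push_cast
        ring
  have upper : ∀ m k, wordDist (alternatingRay Γ i j m) (alternatingRay Γ i j (m + k)) ≤ k := by
    intro m k
    induction k with
    | zero => simp [wordDist_self]
    | succ k ih =>
      refine (wordDist_triangle _ (alternatingRay Γ i j (m + k)) _).trans ?_
      refine add_le_add ih ?_
      rw [← add_assoc, alternatingRay, wordDist, inv_mul_cancel_left, wordLength, racgGen,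
        CoxeterSystem.length_simple]
  intro m n hmn
  obtain ⟨k, rfl⟩ := Nat.exists_eq_add_of_le hmn
  have h1 := lower (alternatingRay Γ i j m) (alternatingRay Γ i j (m + k))
  rw [step, step] at h1
  simp only [neg_zero, ite_self, add_zero] at h1
  have h2 := upper m k
  rw [abs_sub_comm, Nat.cast_add, add_sub_cancel_left, Nat.abs_cast] at h1
  omega

end Busemann

/-! ### Geodesic and shortlex words, prefixes and suffixes -/

section Words

variable {V : Type*} (Γ : SimpleGraph V)

/-- A word is geodesic if no shorter word spells the same element. -/
def IsGeodesicWord (l : List V) : Prop := wordLength (spell Γ l) = l.length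

/-- A word is shortlex if it is geodesic and alphabetically first among the geodesic words that
spell the same element. -/
def IsShortlex [LinearOrder V] (l : List V) : Prop :=
  IsGeodesicWord Γ l ∧ ∀ l' : List V, IsGeodesicWord Γ l' → spell Γ l' = spell Γ l → l ≤ l'

/-- One swap of two consecutive letters that span an edge of `Γ`. -/
inductive SwapStep : List V → List V → Prop
  | swap (l₁ l₂ : List V) (u v : V) (huv : Γ.Adj u v) :
      SwapStep (l₁ ++ u :: v :: l₂) (l₁ ++ v :: u :: l₂)

/-- A rearrangement of a word: the result of a finite sequence of swaps. -/
def IsRearrangement : List V → List V → Prop := Relation.ReflTransGen (SwapStep Γ)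

/-- `w =_Geo p s` is a prefix-suffix decomposition of the shortlex word `w`, with respect to the
letters `a_i` and `a_j`. -/
structure IsPrefixSuffixDecomposition [LinearOrder V] (i j : V) (w p s : List V) : Prop where
  shortlex : IsShortlex Γ w
  spell_eq : spell Γ (p ++ s) = spell Γ w
  geodesic : IsGeodesicWord Γ (p ++ s)
  prefix_letters : ∀ v ∈ p, v = i ∨ v = j
  suffix_shortlex : IsShortlex Γ s
  suffix_start : ∀ s' : List V, IsRearrangement Γ s s' → s'.head? ≠ some i ∧ s'.head? ≠ some j

variable {Γ} in
/-- The (prefix-suffix decomposition of the shortlex word of the) element `g` has empty suffix. -/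
def HasEmptySuffix [LinearOrder V] (i j : V) (g : RACG Γ) : Prop :=
  ∃ w p : List V, spell Γ w = g ∧ IsPrefixSuffixDecomposition Γ i j w p []

end Words

/-! ### Rips graphs -/

/-- The `k`-Rips graph on a metric space: distinct points are joined if and only if their distance
is at most `k`. -/
def ripsGraph (k : ℝ) (X : Type*) [MetricSpace X] : SimpleGraph X where
  Adj x y := x ≠ y ∧ dist x y ≤ k
  symm := ⟨fun x y h => ⟨h.1.symm, by rw [dist_comm]; exact h.2⟩⟩
  loopless := ⟨fun _ h => h.1 rfl⟩

end

/-!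
Fix a geodesic ray from the identity and let `b` be its Busemann function. Multiplying by a
generator on the right changes `b` by `1` or `-1`. Two facts about descents in a right-angled
Coxeter group control these changes: the descents of an element form a clique
(`adj_of_isRightDescent`), and commuting generators do not affect each other's being a descent
(`isRightDescent_mul_iff_of_adj`). Both come from a cocycle with values in `ℤ/2` that records the
reflections shortening an element (`exists_descentCocycle`). Looking from a far enough point of the
ray, both carry over to `b`.

The key step is that paths lift from a horosphere to the next one
(`horosphereConnected_of_horosphereConnected`). The upper neighbours of one element are at pairwise
distance at most `2`. If `u = q z` and `u' = q z'` are joined through a lower neighbour `q`, then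
the generators that decrease `b` at `q` form a clique `K`, and neither `z` nor `z'` lies in it.
Since `Γ ∖ K` is connected, there is a path `z = z₀, …, zᵣ = z'` in it, and each `q zₘ zₘ₊₁` is a
common upper neighbour of `q zₘ` and `q zₘ₊₁`, so the upper neighbours of `u` and of `u'` are
connected with each other.

A geodesic from any `w` to a far enough point of the ray decreases `b` at every step
(`busemann_induction`). For the ray `(a_i a_j)^∞`, the elements with empty suffix are those of the
infinite dihedral subgroup generated by `a_i` and `a_j` (`hasEmptySuffix_iff`). This subgroup is a
line along which `b` is strictly monotone, so it meets every horosphere once. Lifting the constant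
path at a point of the ray back along the geodesic connects `w` with the element of the dihedral
subgroup on its horosphere (`horosphereConnected_of_mem_closure`).
-/

/-! ### Inversions and descents -/

section Inversions

variable {V : Type*} {Γ : SimpleGraph V}

open Classical in
/-- The homomorphism to `ℤ/2` that kills every generator but `x` tells `x` from the others. -/
theorem racgGen_injective : Function.Injective (racgGen Γ) := by
  intro x y hxy
  by_contra hne
  let f : V → Multiplicative (ZMod 2) := fun v => if v = x then Multiplicative.ofAdd 1 else 1
  have sq : ∀ a : Multiplicative (ZMod 2), a ^ 2 = 1 := by decide
  have hf : (racgMatrix Γ).IsLiftable f := by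
    intro u v
    by_cases huv : u = v
    · subst huv
      simp [← pow_two, sq]
    by_cases ha : Γ.Adj u v
    · rw [show (racgMatrix Γ).M u v = 2 by simp [racgMatrix, huv, ha], sq]
    · rw [show (racgMatrix Γ).M u v = 0 by simp [racgMatrix, huv, ha], pow_zero]
  have h := congrArg ((racgSystem Γ).lift ⟨f, hf⟩) hxy
  rw [racgGen, racgGen, CoxeterSystem.lift_apply_simple, CoxeterSystem.lift_apply_simple] at h
  simp only [f, if_true, if_neg (Ne.symm hne)] at h
  exact absurd h (by decide)

theorem racgGen_mul_comm {u v : V} (huv : Γ.Adj u v) :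
    racgGen Γ u * racgGen Γ v = racgGen Γ v * racgGen Γ u := by
  have h := (racgSystem Γ).simple_mul_simple_pow u v
  have hM : (racgMatrix Γ).M u v = 2 := by simp [racgMatrix, huv, huv.ne]
  rw [hM, pow_two] at h
  have h2 := mul_eq_one_iff_eq_inv.mp h
  simpa using h2

open Classical in
/-- The number of occurrences of `t` in the right inversion sequence of a word depends, modulo `2`,
only on the element that the word spells, and it is a cocycle. It is read off from an action of
`W_Γ` on `W_Γ × ℤ/2` in which a generator `s` conjugates the first coordinate and flips the second
one exactly over `s`. -/
theorem exists_inversionParity (Γ : SimpleGraph V) :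
    ∃ η : RACG Γ → RACG Γ → ZMod 2,
      (∀ g h t, η (g * h) t = η g (h * t * h⁻¹) + η h t) ∧
      ∀ (l : List V) (t : RACG Γ),
        η (spell Γ l) t = ((racgSystem Γ).rightInvSeq l).count t := by
  let f : V → Equiv.Perm (RACG Γ × ZMod 2) := fun v => Function.Involutive.toPerm
    (fun p => (racgGen Γ v * p.1 * racgGen Γ v, p.2 + if p.1 = racgGen Γ v then 1 else 0)) <| by
      rintro ⟨t, ε⟩
      have h : racgGen Γ v * t * racgGen Γ v = racgGen Γ v ↔ t = racgGen Γ v := by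
        constructor
        · intro h
          simpa [mul_assoc] using congrArg (fun a => racgGen Γ v * a * racgGen Γ v) h
        · rintro rfl; simp
      have h2 : (1 : ZMod 2) + 1 = 0 := by decide
      simp only [h]
      split_ifs <;> simp [mul_assoc, add_assoc, h2]
  have f_apply : ∀ v t ε, f v (t, ε) =
      (racgGen Γ v * t * racgGen Γ v, ε + if t = racgGen Γ v then 1 else 0) := fun _ _ _ => rfl
  have sq : ∀ v, f v * f v = 1 := fun v => by
    ext1 p
    exact Function.Involutive.toPerm_involutive _ p
  have conj : ∀ u v, Γ.Adj u v → ∀ t : RACG Γ,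
      racgGen Γ v * t * racgGen Γ v = racgGen Γ u ↔ t = racgGen Γ u := by
    intro u v huv t
    have hc := racgGen_mul_comm huv
    constructor
    · intro h
      have := congrArg (fun a => racgGen Γ v * a * racgGen Γ v) h
      simpa [mul_assoc, hc] using this
    · rintro rfl
      rw [mul_assoc, hc]
      simp
  have hf : (racgMatrix Γ).IsLiftable f := by
    intro u v
    by_cases huv : u = v
    · subst huv
      simp [sq]
    by_cases ha : Γ.Adj u v
    · rw [show (racgMatrix Γ).M u v = 2 by simp [racgMatrix, huv, ha]]
      have hc : f u * f v = f v * f u := by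
        ext1 ⟨t, ε⟩
        have hg := racgGen_mul_comm ha
        rw [Equiv.Perm.mul_apply, Equiv.Perm.mul_apply, f_apply, f_apply, f_apply, f_apply]
        simp only [conj u v ha, conj v u ha.symm]
        refine Prod.ext ?_ (add_right_comm _ _ _)
        calc _ = (racgGen Γ u * racgGen Γ v) * t * (racgGen Γ v * racgGen Γ u) := by
              simp only [mul_assoc]
          _ = (racgGen Γ v * racgGen Γ u) * t * (racgGen Γ u * racgGen Γ v) := by rw [hg]
          _ = _ := by simp only [mul_assoc]
      rw [pow_two, mul_assoc, ← mul_assoc (f v), ← hc, mul_assoc, sq, mul_one, sq]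
    · rw [show (racgMatrix Γ).M u v = 0 by simp [racgMatrix, huv, ha], pow_zero]
  let ρ := (racgSystem Γ).lift ⟨f, hf⟩
  have hρ : ∀ (l : List V) (t : RACG Γ) (ε : ZMod 2), ρ (spell Γ l) (t, ε) =
      (spell Γ l * t * (spell Γ l)⁻¹, ε + ((racgSystem Γ).rightInvSeq l).count t) := by
    intro l
    induction l with
    | nil => intro t ε; simp [spell]
    | cons v l ih =>
      intro t ε
      have hv : ρ (racgGen Γ v) = f v := (racgSystem Γ).lift_apply_simple hf v
      rw [spell, CoxeterSystem.wordProd_cons, map_mul, Equiv.Perm.mul_apply, ih]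
      rw [show ρ ((racgSystem Γ).simple v) = f v from hv, f_apply, CoxeterSystem.rightInvSeq,
        List.count_cons]
      have h : spell Γ l * t * (spell Γ l)⁻¹ = racgGen Γ v ↔
          (spell Γ l)⁻¹ * racgGen Γ v * spell Γ l = t := by
        constructor
        · intro h; rw [← h]; group
        · rintro rfl; group
      simp only [h, beq_iff_eq]
      refine Prod.ext ?_ ?_
      · simp [mul_assoc]
      · push_cast
        rw [add_assoc]
  have spell_surj : ∀ g : RACG Γ, ∃ l, g = spell Γ l := fun g =>
    ((racgSystem Γ).exists_isReduced g).imp fun _ h => h.2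
  refine ⟨fun g t => (ρ g (t, 0)).2, fun g h t => ?_, fun l t => by simp [hρ]⟩
  obtain ⟨l, rfl⟩ := spell_surj g
  obtain ⟨m, rfl⟩ := spell_surj h
  simp only [map_mul, Equiv.Perm.mul_apply, hρ]
  ring

/-- A cocycle that detects descents. If `η g t = 1`, then `t` occurs in the right inversion sequence
of a reduced word for `g`, hence shortens `g`. If the generator `v` shortens `g`, then it does not
shorten `g * v`, so `η (g * v) v = 0`, and the cocycle identity gives `η g v = 1`. -/
theorem exists_descentCocycle (Γ : SimpleGraph V) :
    ∃ η : RACG Γ → RACG Γ → ZMod 2,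
      (∀ g h t, η (g * h) t = η g (h * t * h⁻¹) + η h t) ∧
      (∀ g t, η g t = 1 → wordLength (g * t) < wordLength g) ∧
      ∀ g v, η g (racgGen Γ v) = 1 ↔ (racgSystem Γ).IsRightDescent g v := by
  classical
  obtain ⟨η, hmul, hcount⟩ := exists_inversionParity Γ
  have short : ∀ g t, η g t = 1 → wordLength (g * t) < wordLength g := by
    intro g t h
    obtain ⟨l, hl, rfl⟩ := (racgSystem Γ).exists_isReduced g
    have hcount' := hcount l t
    rw [h] at hcount'
    have mem : t ∈ (racgSystem Γ).rightInvSeq l := by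
      rw [← List.count_pos_iff, Nat.pos_iff_ne_zero]
      intro h0
      rw [h0] at hcount'
      exact absurd hcount' (by decide)
    exact ((racgSystem Γ).isRightInversion_of_mem_rightInvSeq hl mem).2
  refine ⟨η, hmul, short, fun g v => ⟨short g _, fun h => ?_⟩⟩
  have h1 : η (racgGen Γ v) (racgGen Γ v) = 1 := by
    have := hcount [v] (racgGen Γ v)
    simpa [spell] using this
  have h2 := hmul g (racgGen Γ v) (racgGen Γ v)
  rw [h1, mul_assoc, mul_inv_cancel, mul_one] at h2
  have h3 : η (g * racgGen Γ v) (racgGen Γ v) ≠ 1 := fun h4 => by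
    have := short _ _ h4
    rw [mul_assoc, racgGen, CoxeterSystem.simple_mul_simple_self, mul_one] at this
    exact lt_asymm this h
  revert h2 h3
  generalize η (g * racgGen Γ v) (racgGen Γ v) = a
  generalize η g (racgGen Γ v) = b
  revert a b
  decide

theorem isRightDescent_mul_iff_of_adj {x y : V} (hxy : Γ.Adj x y) (g : RACG Γ) :
    (racgSystem Γ).IsRightDescent (g * racgGen Γ x) y ↔ (racgSystem Γ).IsRightDescent g y := by
  obtain ⟨η, hmul, -, hdesc⟩ := exists_descentCocycle Γ
  have h0 : η (racgGen Γ x) (racgGen Γ y) = 0 := by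
    have h1 : ¬ (racgSystem Γ).IsRightDescent (racgGen Γ x) y := by
      rw [CoxeterSystem.IsRightDescent, CoxeterSystem.length_simple, Nat.lt_one_iff,
        CoxeterSystem.length_eq_zero_iff]
      intro h
      rw [mul_eq_one_iff_eq_inv, CoxeterSystem.inv_simple] at h
      exact hxy.ne (racgGen_injective h)
    rw [← hdesc] at h1
    revert h1
    generalize η (racgGen Γ x) (racgGen Γ y) = a
    revert a
    decide
  rw [← hdesc, ← hdesc, hmul, h0, add_zero, racgGen_mul_comm hxy, mul_inv_cancel_right]

end Inversions

/-! ### Infinite dihedral subgroups and their cosets -/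

section Dihedral

variable {V : Type*} {Γ : SimpleGraph V}

/-- The ray satisfies a recursion on the left as well, which exchanges the two letters. -/
theorem alternatingRay_succ_left (i j : V) (n : ℕ) :
    alternatingRay Γ i j (n + 1) = racgGen Γ i * alternatingRay Γ j i n := by
  induction n with
  | zero => simp [alternatingRay]
  | succ n ih =>
    rw [alternatingRay, ih, alternatingRay, mul_assoc]
    by_cases hn : Even n <;> simp [hn, Nat.even_add_one]

theorem alternatingRay_mem_closure (i j : V) (n : ℕ) :
    alternatingRay Γ i j n ∈ Subgroup.closure {racgGen Γ i, racgGen Γ j} := by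
  induction n with
  | zero => exact one_mem _
  | succ n ih =>
    refine mul_mem ih (Subgroup.subset_closure ?_)
    split_ifs <;> simp

/-- The elements of a dihedral subgroup are the points of the two alternating rays that start at
the identity. -/
theorem mem_closure_pair_iff {i j : V} {g : RACG Γ} :
    g ∈ Subgroup.closure {racgGen Γ i, racgGen Γ j} ↔
      ∃ n, g = alternatingRay Γ i j n ∨ g = alternatingRay Γ j i n := by
  constructor
  · have step : ∀ (i j : V) (g : RACG Γ),
        (∃ n, g = alternatingRay Γ i j n ∨ g = alternatingRay Γ j i n) →
        ∃ n, racgGen Γ i * g = alternatingRay Γ i j n ∨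
          racgGen Γ i * g = alternatingRay Γ j i n := by
      rintro i j g ⟨n, rfl | rfl⟩
      · cases n with
        | zero => exact ⟨1, Or.inl (by simp [alternatingRay])⟩
        | succ n =>
          exact ⟨n, Or.inr (by
            rw [alternatingRay_succ_left, racgGen, CoxeterSystem.simple_mul_simple_cancel_left])⟩
      · exact ⟨n + 1, Or.inl (alternatingRay_succ_left i j n).symm⟩
    have gen : ∀ x ∈ ({racgGen Γ i, racgGen Γ j} : Set (RACG Γ)), ∀ g : RACG Γ,
        (∃ n, g = alternatingRay Γ i j n ∨ g = alternatingRay Γ j i n) →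
        ∃ n, x * g = alternatingRay Γ i j n ∨ x * g = alternatingRay Γ j i n := by
      rintro x (rfl | rfl) g hg
      · exact step i j g hg
      · exact (step j i g (hg.imp fun _ => Or.symm)).imp fun _ => Or.symm
    intro hg
    induction hg using Subgroup.closure_induction_left with
    | one => exact ⟨0, Or.inl rfl⟩
    | mul_left x hx y _ ih => exact gen x hx y ih
    | inv_mul_cancel x hx y _ ih =>
      have : x⁻¹ = x := by rcases hx with rfl | rfl <;> simp
      rw [this]
      exact gen x hx y ih
  · rintro ⟨n, rfl | rfl⟩
    · exact alternatingRay_mem_closure i j n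
    · rw [Set.pair_comm]
      exact alternatingRay_mem_closure j i n

theorem wordLength_alternatingRay {i j : V} (hij : i ≠ j) (hadj : ¬ Γ.Adj i j) (n : ℕ) :
    wordLength (alternatingRay Γ i j n) = n := by
  have h := isGeodesicRay_alternatingRay hij hadj 0 n (Nat.zero_le n)
  simpa [wordDist, alternatingRay] using h

/-- Lengths add up for the product of a shortest element `h` of a coset of a dihedral subgroup and
an alternating word. If the last letter shortened `h * a`, where it does not shorten `a`, then by the
cocycle identity a reflection of the dihedral subgroup would shorten `h`. -/
theorem wordLength_mul_alternatingRay {x y : V} (hxy : x ≠ y) (hadj : ¬ Γ.Adj x y) {h : RACG Γ}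
    (hmin : ∀ a ∈ Subgroup.closure {racgGen Γ x, racgGen Γ y}, wordLength h ≤ wordLength (h * a))
    (n : ℕ) : wordLength (h * alternatingRay Γ x y n) = wordLength h + n := by
  obtain ⟨η, hmul, hshort, hdesc⟩ := exists_descentCocycle Γ
  induction n with
  | zero => simp [alternatingRay]
  | succ n ih =>
    obtain ⟨z, hz⟩ : ∃ z, alternatingRay Γ x y (n + 1) = alternatingRay Γ x y n * racgGen Γ z :=
      ⟨_, rfl⟩
    have ha := wordLength_alternatingRay hxy hadj n
    have ha' := wordLength_alternatingRay hxy hadj (n + 1)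
    have key : ¬ (racgSystem Γ).IsRightDescent (h * alternatingRay Γ x y n) z := by
      intro hd
      have h0 : ¬ (racgSystem Γ).IsRightDescent (alternatingRay Γ x y n) z := by
        rw [CoxeterSystem.IsRightDescent, ← racgGen, ← hz]
        change ¬ wordLength _ < wordLength _
        omega
      rw [← hdesc] at hd h0
      rw [hmul] at hd
      have h1 : η h (alternatingRay Γ x y n * racgGen Γ z * (alternatingRay Γ x y n)⁻¹) = 1 := by
        revert hd h0
        generalize η (alternatingRay Γ x y n) (racgGen Γ z) = a
        generalize η h _ = b
        revert a b
        decide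
      refine absurd (hshort _ _ h1) (not_lt.mpr (hmin _ ?_))
      rw [← hz]
      exact mul_mem (alternatingRay_mem_closure x y _)
        (inv_mem (alternatingRay_mem_closure x y _))
    rw [CoxeterSystem.not_isRightDescent_iff] at key
    rw [hz, ← mul_assoc]
    change wordLength _ = wordLength _ + 1 at key
    rw [key, ih, add_assoc]

/-- The descents of an element form a clique: in a coset of an infinite dihedral subgroup, the
alternating words starting at a shortest element can always be prolonged, by one letter or the
other. -/
theorem adj_of_isRightDescent {x y : V} (hxy : x ≠ y) {g : RACG Γ}
    (hx : (racgSystem Γ).IsRightDescent g x) (hy : (racgSystem Γ).IsRightDescent g y) :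
    Γ.Adj x y := by
  by_contra hadj
  obtain ⟨h, hh, hmin⟩ := exists_minimalFor_of_wellFoundedLT
    (fun h : RACG Γ => h⁻¹ * g ∈ Subgroup.closure {racgGen Γ x, racgGen Γ y}) wordLength
    ⟨g, by simp⟩
  have hmin' : ∀ a ∈ Subgroup.closure {racgGen Γ x, racgGen Γ y},
      wordLength h ≤ wordLength (h * a) := by
    intro a ha
    rcases le_total (wordLength h) (wordLength (h * a)) with h1 | h1
    · exact h1
    · refine hmin (show (h * a)⁻¹ * g ∈ _ from ?_) h1
      rw [mul_inv_rev, mul_assoc]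
      exact mul_mem (inv_mem ha) hh
  have up : ∀ u v : V, u ≠ v → ¬ Γ.Adj u v → (racgSystem Γ).IsRightDescent g u →
      (racgSystem Γ).IsRightDescent g v → (∀ a ∈ Subgroup.closure {racgGen Γ u, racgGen Γ v},
      wordLength h ≤ wordLength (h * a)) → ∀ n, h⁻¹ * g ≠ alternatingRay Γ u v n := by
    intro u v huv hadj hu hv hmin'' n hn
    obtain rfl : g = h * alternatingRay Γ u v n := by rw [← hn, mul_inv_cancel_left]
    have h1 := wordLength_mul_alternatingRay huv hadj hmin'' n
    have h2 := wordLength_mul_alternatingRay huv hadj hmin'' (n + 1)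
    have h3 : (racgSystem Γ).IsRightDescent (h * alternatingRay Γ u v n)
        (if Even n then u else v) := by
      split_ifs <;> assumption
    rw [CoxeterSystem.IsRightDescent, mul_assoc] at h3
    change wordLength (h * alternatingRay Γ u v (n + 1)) < wordLength _ at h3
    omega
  obtain ⟨n, hn | hn⟩ := mem_closure_pair_iff.mp hh
  · exact up x y hxy hadj hx hy hmin' n hn
  · refine up y x hxy.symm (fun h => hadj h.symm) hy hx ?_ n hn
    rwa [Set.pair_comm]

end Dihedral

/-! ### Descents of Busemann functions -/

section BusemannDescent

variable {V : Type*} {Γ : SimpleGraph V} {γ : ℕ → RACG Γ}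

theorem eventually_wordDist_sub_eq_busemann (hγ : IsGeodesicRay γ) (h0 : γ 0 = 1) (w : RACG Γ) :
    ∀ᶠ n : ℕ in atTop, (wordDist (γ n) w : ℤ) - n = busemann γ w := by
  have h := tendsto_busemann hγ w
  rw [nhds_discrete, tendsto_pure] at h
  filter_upwards [h] with n hn
  have h1 := hγ 0 n (Nat.zero_le n)
  rw [h0, wordDist_comm] at h1
  rw [← hn, h1]
  simp

theorem busemann_le_wordDist_sub (hγ : IsGeodesicRay γ) (h0 : γ 0 = 1) (w : RACG Γ) (n : ℕ) :
    busemann γ w ≤ wordDist (γ n) w - n := by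
  obtain ⟨m, hm, hnm⟩ :=
    ((eventually_wordDist_sub_eq_busemann hγ h0 w).and (eventually_ge_atTop n)).exists
  have h1 := wordDist_triangle (γ m) (γ n) w
  have h2 := hγ n m hnm
  rw [wordDist_comm] at h2
  omega

/-- Seen from a far enough point of the ray, a generator shortens `w` if it lowers the Busemann
function, and lengthens `w` if it raises it. -/
theorem eventually_isRightDescent_or_not (hγ : IsGeodesicRay γ) (h0 : γ 0 = 1) (w : RACG Γ)
    (x : V) :
    ∀ᶠ n : ℕ in atTop,
      ((racgSystem Γ).IsRightDescent ((γ n)⁻¹ * w) x ∧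
          busemann γ (w * racgGen Γ x) = busemann γ w - 1) ∨
        (¬ (racgSystem Γ).IsRightDescent ((γ n)⁻¹ * w) x ∧
          busemann γ (w * racgGen Γ x) = busemann γ w + 1) := by
  filter_upwards [eventually_wordDist_sub_eq_busemann hγ h0 w,
    eventually_wordDist_sub_eq_busemann hγ h0 (w * racgGen Γ x)] with n h1 h2
  rw [wordDist, wordLength] at h1 h2
  rw [← mul_assoc] at h2
  by_cases hd : (racgSystem Γ).IsRightDescent ((γ n)⁻¹ * w) x
  · refine Or.inl ⟨hd, ?_⟩
    rw [CoxeterSystem.isRightDescent_iff] at hd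
    change (racgSystem Γ).length ((γ n)⁻¹ * w * racgGen Γ x) + 1 = _ at hd
    rw [← h1, ← h2]
    omega
  · refine Or.inr ⟨hd, ?_⟩
    rw [CoxeterSystem.not_isRightDescent_iff] at hd
    change (racgSystem Γ).length ((γ n)⁻¹ * w * racgGen Γ x) = _ at hd
    rw [← h1, ← h2]
    omega

theorem busemann_mul_gen (hγ : IsGeodesicRay γ) (h0 : γ 0 = 1) (w : RACG Γ) (x : V) :
    busemann γ (w * racgGen Γ x) = busemann γ w - 1 ∨
      busemann γ (w * racgGen Γ x) = busemann γ w + 1 := by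
  obtain ⟨n, hn⟩ := (eventually_isRightDescent_or_not hγ h0 w x).exists
  exact hn.imp And.right And.right

theorem adj_of_busemann_descent (hγ : IsGeodesicRay γ) (h0 : γ 0 = 1) {w : RACG Γ} {x y : V}
    (hxy : x ≠ y) (hx : busemann γ (w * racgGen Γ x) = busemann γ w - 1)
    (hy : busemann γ (w * racgGen Γ y) = busemann γ w - 1) : Γ.Adj x y := by
  obtain ⟨n, h1, h2⟩ := ((eventually_isRightDescent_or_not hγ h0 w x).and
    (eventually_isRightDescent_or_not hγ h0 w y)).exists
  refine adj_of_isRightDescent (g := (γ n)⁻¹ * w) hxy ?_ ?_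
  · exact (h1.resolve_right (by omega)).1
  · exact (h2.resolve_right (by omega)).1

theorem busemann_mul_gen_mul_gen (hγ : IsGeodesicRay γ) (h0 : γ 0 = 1) {w : RACG Γ} {x y : V}
    (hxy : Γ.Adj x y) (hx : busemann γ (w * racgGen Γ x) = busemann γ w + 1)
    (hy : busemann γ (w * racgGen Γ y) = busemann γ w + 1) :
    busemann γ (w * racgGen Γ x * racgGen Γ y) = busemann γ w + 2 := by
  obtain ⟨n, h1, h2⟩ := ((eventually_isRightDescent_or_not hγ h0 w y).and
    (eventually_isRightDescent_or_not hγ h0 (w * racgGen Γ x) y)).exists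
  rw [← mul_assoc, isRightDescent_mul_iff_of_adj hxy] at h2
  have h3 := (h1.resolve_left (by omega)).1
  have h4 := (h2.resolve_left fun h => h3 h.1).2
  omega

/-- Every element is reached from a point of the ray by right multiplications by generators that
raise the Busemann function: such steps, read backwards, are a geodesic towards a far enough point
of the ray. -/
theorem busemann_induction (hγ : IsGeodesicRay γ) (h0 : γ 0 = 1) {P : RACG Γ → Prop}
    (ray : ∀ n, P (γ n))
    (up : ∀ u x, P u → busemann γ (u * racgGen Γ x) = busemann γ u + 1 → P (u * racgGen Γ x))
    (w : RACG Γ) : P w := by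
  obtain ⟨N, hN⟩ := (eventually_wordDist_sub_eq_busemann hγ h0 w).exists
  have main : ∀ (m : ℕ) (u : RACG Γ), wordDist (γ N) u = m → (m : ℤ) - N = busemann γ u → P u := by
    intro m
    induction m with
    | zero =>
      intro u hu _
      rw [← eq_of_wordDist_eq_zero hu]
      exact ray N
    | succ m ih =>
      intro u hu hb
      have hne : (γ N)⁻¹ * u ≠ 1 := by
        intro h
        rw [wordDist, h, wordLength, CoxeterSystem.length_one] at hu
        omega
      obtain ⟨x, hx⟩ := (racgSystem Γ).exists_rightDescent_of_ne_one hne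
      rw [CoxeterSystem.isRightDescent_iff, mul_assoc] at hx
      change wordDist (γ N) (u * racgGen Γ x) + 1 = wordDist (γ N) u at hx
      have h1 := busemann_le_wordDist_sub hγ h0 (u * racgGen Γ x) N
      have h2 := busemann_mul_gen hγ h0 u x
      have h3 : P (u * racgGen Γ x) := ih _ (by omega) (by omega)
      have h4 : u * racgGen Γ x * racgGen Γ x = u := by simp [mul_assoc]
      rw [← h4]
      refine up _ x h3 ?_
      rw [h4]
      omega
  exact main _ w rfl hN

end BusemannDescent

/-! ### Lifting paths between horospheres -/

section RipsPaths

variable {V : Type*} {Γ : SimpleGraph V} {γ : ℕ → RACG Γ}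

/-- `v` and `w` lie on the same horosphere at distance at most `2`: they are equal or joined by an
edge of the `2`-Rips graph on that horosphere. -/
def HorosphereStep (γ : ℕ → RACG Γ) (v w : RACG Γ) : Prop :=
  busemann γ v = busemann γ w ∧ wordDist v w ≤ 2

/-- `v` and `w` are joined by a path in the `2`-Rips graph on their common horosphere. -/
abbrev HorosphereConnected (γ : ℕ → RACG Γ) : RACG Γ → RACG Γ → Prop :=
  Relation.ReflTransGen (HorosphereStep γ)

theorem HorosphereConnected.reachable {v w : RACG Γ} (h : HorosphereConnected γ v w) {k : ℤ}
    (hv : v ∈ horosphere γ k) (hw : w ∈ horosphere γ k) :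
    (ripsGraph 2 (horosphere γ k)).Reachable ⟨v, hv⟩ ⟨w, hw⟩ := by
  induction h with
  | refl => rfl
  | @tail u w _ huw ih =>
    have hu : u ∈ horosphere γ k := huw.1.trans hw
    refine (ih hu).trans ?_
    by_cases h : u = w
    · subst h
      rfl
    · refine SimpleGraph.Adj.reachable ⟨fun h' => h (congrArg Subtype.val h'), ?_⟩
      rw [Subtype.dist_eq, dist_eq_wordDist]
      exact_mod_cast huw.2

theorem wordDist_mul_gen_mul_gen_le (u : RACG Γ) (x y : V) :
    wordDist (u * racgGen Γ x) (u * racgGen Γ y) ≤ 2 := by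
  have h := (racgSystem Γ).length_wordProd_le [x, y]
  rw [wordDist, mul_inv_rev, mul_assoc, inv_mul_cancel_left, CoxeterSystem.inv_simple]
  simpa [CoxeterSystem.wordProd_cons] using h

theorem horosphereStep_of_ascents {u : RACG Γ} {x y : V}
    (hx : busemann γ (u * racgGen Γ x) = busemann γ u + 1)
    (hy : busemann γ (u * racgGen Γ y) = busemann γ u + 1) :
    HorosphereStep γ (u * racgGen Γ x) (u * racgGen Γ y) :=
  ⟨hx.trans hy.symm, wordDist_mul_gen_mul_gen_le u x y⟩

/-- The vertices that do not raise the Busemann function at `q` form a clique, so any two ascents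
`z`, `z'` of `q` are joined by a path of ascents in `Γ`, and consecutive ones commute. This gives a
path two levels above `q`. -/
theorem horosphereConnected_of_fork (hΓ : StandingAssumptions Γ) (hγ : IsGeodesicRay γ)
    (h0 : γ 0 = 1) {q : RACG Γ} {z z' x y : V}
    (hz : busemann γ (q * racgGen Γ z) = busemann γ q + 1)
    (hz' : busemann γ (q * racgGen Γ z') = busemann γ q + 1)
    (hx : busemann γ (q * racgGen Γ z * racgGen Γ x) = busemann γ q + 2)
    (hy : busemann γ (q * racgGen Γ z' * racgGen Γ y) = busemann γ q + 2) :
    HorosphereConnected γ (q * racgGen Γ z * racgGen Γ x) (q * racgGen Γ z' * racgGen Γ y) := by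
  let K : Set V := {v | busemann γ (q * racgGen Γ v) = busemann γ q - 1}
  have hK : Γ.IsClique K := fun u hu v hv huv => adj_of_busemann_descent hγ h0 huv hu hv
  have mem : ∀ v, v ∈ Kᶜ ↔ busemann γ (q * racgGen Γ v) = busemann γ q + 1 := by
    intro v
    have := busemann_mul_gen hγ h0 q v
    simp only [K, Set.mem_compl_iff, Set.mem_ofPred_eq]
    omega
  obtain ⟨p⟩ := hΓ.no_separating_clique K hK ⟨z, (mem z).mpr hz⟩ ⟨z', (mem z').mpr hz'⟩
  have main : ∀ (a b : ↥Kᶜ), (Γ.induce Kᶜ).Walk a b → ∀ x y : V,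
      busemann γ (q * racgGen Γ a * racgGen Γ x) = busemann γ q + 2 →
      busemann γ (q * racgGen Γ b * racgGen Γ y) = busemann γ q + 2 →
      HorosphereConnected γ (q * racgGen Γ a * racgGen Γ x) (q * racgGen Γ b * racgGen Γ y) := by
    intro a b p
    induction p with
    | @nil a =>
      intro x y hx hy
      have ha := (mem a).mp a.2
      exact .single (horosphereStep_of_ascents (by omega) (by omega))
    | @cons a c b hac p ih =>
      intro x y hx hy
      have hac' : Γ.Adj a c := hac
      have ha := (mem a).mp a.2
      have hc := (mem c).mp c.2
      have hb := busemann_mul_gen_mul_gen hγ h0 hac' ha hc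
      have hcomm : q * racgGen Γ a * racgGen Γ c = q * racgGen Γ c * racgGen Γ a := by
        rw [mul_assoc, racgGen_mul_comm hac', mul_assoc]
      -- `q * a * c = q * c * a` is an upper neighbour of `q * a` and of `q * c`
      refine .head (horosphereStep_of_ascents (y := (c : V)) (by omega) (by omega)) ?_
      rw [hcomm] at hb ⊢
      exact ih a y hb hy
  exact main _ _ p x y hx hy

/-- Two elements at distance `2` on a horosphere are neighbours of a common element, which is one
level above or one level below. In the first case it is itself an upper neighbour of both, in the
second case the two elements are the upper prongs of a fork. -/
theorem horosphereConnected_of_step (hΓ : StandingAssumptions Γ) (hγ : IsGeodesicRay γ)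
    (h0 : γ 0 = 1) {u u' : RACG Γ} {x y : V} (huu' : HorosphereStep γ u u')
    (hx : busemann γ (u * racgGen Γ x) = busemann γ u + 1)
    (hy : busemann γ (u' * racgGen Γ y) = busemann γ u' + 1) :
    HorosphereConnected γ (u * racgGen Γ x) (u' * racgGen Γ y) := by
  obtain ⟨hb, hd⟩ := huu'
  obtain ⟨l, hl, hul⟩ := (racgSystem Γ).exists_isReduced (u⁻¹ * u')
  rw [wordDist, wordLength, hul, hl.eq] at hd
  obtain rfl : u' = u * spell Γ l := by rw [spell, ← hul, mul_inv_cancel_left]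
  match l, hd with
  | [], _ =>
    simp only [spell, CoxeterSystem.wordProd_nil, mul_one] at hy ⊢
    exact .single (horosphereStep_of_ascents hx hy)
  | [z], _ =>
    -- impossible, since every generator changes the value of the Busemann function
    have hz := busemann_mul_gen hγ h0 u z
    rw [show spell Γ [z] = racgGen Γ z from CoxeterSystem.wordProd_singleton _ z] at hb
    omega
  | [z, z'], _ =>
    have hs : u * spell Γ [z, z'] = u * racgGen Γ z * racgGen Γ z' := by
      simp [spell, CoxeterSystem.wordProd_cons, mul_assoc]
    rw [hs] at hb hy ⊢
    have hzz : u * racgGen Γ z * racgGen Γ z = u := by simp [mul_assoc]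
    have hzz' : u * racgGen Γ z * racgGen Γ z' * racgGen Γ z' = u * racgGen Γ z := by
      simp [mul_assoc]
    rcases busemann_mul_gen hγ h0 u z with hz | hz
    · have key := horosphereConnected_of_fork hΓ hγ h0 (q := u * racgGen Γ z) (z := z) (z' := z')
        (x := x) (y := y) (by rw [hzz]; omega) (by omega) (by rw [hzz]; omega) (by omega)
      rwa [hzz] at key
    · refine .head (horosphereStep_of_ascents (y := z) hx hz) ?_
      have h2 : busemann γ (u * racgGen Γ z * racgGen Γ z' * racgGen Γ z') =
          busemann γ (u * racgGen Γ z * racgGen Γ z') + 1 := by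
        rw [hzz']
        omega
      have key := horosphereStep_of_ascents h2 hy
      rw [hzz'] at key
      exact .single key

/-- The descents form a clique and `Γ` is not complete, so some generator is not a descent. -/
theorem exists_ascent (hΓ : StandingAssumptions Γ) (hγ : IsGeodesicRay γ) (h0 : γ 0 = 1)
    (u : RACG Γ) : ∃ x, busemann γ (u * racgGen Γ x) = busemann γ u + 1 := by
  by_contra! hcon
  refine hΓ.not_complete (SimpleGraph.eq_top_iff_forall_ne_adj.mpr fun x y hxy => ?_)
  exact adj_of_busemann_descent hγ h0 (w := u) hxy
    ((busemann_mul_gen hγ h0 u x).resolve_right (hcon x))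
    ((busemann_mul_gen hγ h0 u y).resolve_right (hcon y))

/-- A path on a horosphere lifts to a path on the next one, with prescribed upper neighbours of its
endpoints as new endpoints. -/
theorem horosphereConnected_of_horosphereConnected (hΓ : StandingAssumptions Γ)
    (hγ : IsGeodesicRay γ) (h0 : γ 0 = 1) {u u' : RACG Γ} (h : HorosphereConnected γ u u')
    {x y : V} (hx : busemann γ (u * racgGen Γ x) = busemann γ u + 1)
    (hy : busemann γ (u' * racgGen Γ y) = busemann γ u' + 1) :
    HorosphereConnected γ (u * racgGen Γ x) (u' * racgGen Γ y) := by
  induction h generalizing y with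
  | refl => exact .single (horosphereStep_of_ascents hx hy)
  | @tail a b _ hab ih =>
    obtain ⟨z, hz⟩ := exists_ascent hΓ hγ h0 a
    exact (ih hz).trans (horosphereConnected_of_step hΓ hγ h0 hab hz hy)

end RipsPaths

/-! ### The alternating ray -/

section AlternatingRay

variable {V : Type*} {Γ : SimpleGraph V} {i j : V}

theorem wordDist_alternatingRay_swap (hij : i ≠ j) (hadj : ¬ Γ.Adj i j) (m n : ℕ) :
    wordDist (alternatingRay Γ j i m) (alternatingRay Γ i j n) = m + n := by
  induction m generalizing i j n with
  | zero => simp [wordDist, alternatingRay, wordLength_alternatingRay hij hadj]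
  | succ m ih =>
    have h : (alternatingRay Γ j i (m + 1))⁻¹ * alternatingRay Γ i j n =
        (alternatingRay Γ i j m)⁻¹ * alternatingRay Γ j i (n + 1) := by
      rw [alternatingRay_succ_left, alternatingRay_succ_left, mul_inv_rev,
        CoxeterSystem.inv_simple, mul_assoc]
    rw [wordDist, h]
    have := ih hij.symm (fun h => hadj h.symm) (n + 1)
    rw [wordDist] at this
    omega

theorem busemann_alternatingRay (hij : i ≠ j) (hadj : ¬ Γ.Adj i j) (m : ℕ) :
    busemann (alternatingRay Γ i j) (alternatingRay Γ i j m) = -m := by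
  have hγ := isGeodesicRay_alternatingRay hij hadj
  obtain ⟨n, hn, hmn⟩ := ((eventually_wordDist_sub_eq_busemann hγ rfl
    (alternatingRay Γ i j m)).and (eventually_ge_atTop m)).exists
  have h := hγ m n hmn
  rw [wordDist_comm] at h
  omega

theorem busemann_alternatingRay_swap (hij : i ≠ j) (hadj : ¬ Γ.Adj i j) (m : ℕ) :
    busemann (alternatingRay Γ i j) (alternatingRay Γ j i m) = m := by
  have hγ := isGeodesicRay_alternatingRay hij hadj
  obtain ⟨n, hn⟩ := (eventually_wordDist_sub_eq_busemann hγ rfl (alternatingRay Γ j i m)).exists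
  have h := wordDist_alternatingRay_swap hij hadj m n
  rw [wordDist_comm] at h
  omega

theorem exists_mem_closure_busemann_eq (hij : i ≠ j) (hadj : ¬ Γ.Adj i j) (k : ℤ) :
    ∃ v ∈ Subgroup.closure {racgGen Γ i, racgGen Γ j},
      busemann (alternatingRay Γ i j) v = k := by
  obtain ⟨n, rfl | rfl⟩ := k.eq_nat_or_neg
  · exact ⟨_, mem_closure_pair_iff.mpr ⟨n, .inr rfl⟩, busemann_alternatingRay_swap hij hadj n⟩
  · exact ⟨_, mem_closure_pair_iff.mpr ⟨n, .inl rfl⟩, busemann_alternatingRay hij hadj n⟩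

theorem eq_of_mem_closure_of_busemann_eq (hij : i ≠ j) (hadj : ¬ Γ.Adj i j) {v w : RACG Γ}
    (hv : v ∈ Subgroup.closure {racgGen Γ i, racgGen Γ j})
    (hw : w ∈ Subgroup.closure {racgGen Γ i, racgGen Γ j})
    (h : busemann (alternatingRay Γ i j) v = busemann (alternatingRay Γ i j) w) : v = w := by
  have zero : alternatingRay Γ i j 0 = alternatingRay Γ j i 0 := rfl
  obtain ⟨m, rfl | rfl⟩ := mem_closure_pair_iff.mp hv <;>
    obtain ⟨n, rfl | rfl⟩ := mem_closure_pair_iff.mp hw <;>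
    simp only [busemann_alternatingRay hij hadj, busemann_alternatingRay_swap hij hadj] at h
  · rw [show m = n by omega]
  · rw [show m = 0 by omega, show n = 0 by omega, zero]
  · rw [show m = 0 by omega, show n = 0 by omega, zero]
  · rw [show m = n by omega]

/-- The dihedral subgroup is a line on which the Busemann function decreases in one direction. -/
theorem exists_descent_of_mem_closure (hij : i ≠ j) (hadj : ¬ Γ.Adj i j) {v : RACG Γ}
    (hv : v ∈ Subgroup.closure {racgGen Γ i, racgGen Γ j}) :
    ∃ y, v * racgGen Γ y ∈ Subgroup.closure {racgGen Γ i, racgGen Γ j} ∧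
      busemann (alternatingRay Γ i j) (v * racgGen Γ y) =
        busemann (alternatingRay Γ i j) v - 1 := by
  have fwd : ∀ n, ∃ y, alternatingRay Γ i j n * racgGen Γ y = alternatingRay Γ i j (n + 1) :=
    fun n => ⟨_, rfl⟩
  have bwd : ∀ n, ∃ y, alternatingRay Γ j i (n + 1) * racgGen Γ y = alternatingRay Γ j i n :=
    fun n => ⟨_, CoxeterSystem.simple_mul_simple_cancel_right _ _⟩
  obtain ⟨n, rfl | rfl⟩ := mem_closure_pair_iff.mp hv
  · obtain ⟨y, hy⟩ := fwd n
    refine ⟨y, by rw [hy]; exact alternatingRay_mem_closure i j _, ?_⟩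
    rw [hy, busemann_alternatingRay hij hadj, busemann_alternatingRay hij hadj]
    push_cast
    ring
  · cases n with
    | zero =>
      obtain ⟨y, hy⟩ := fwd 0
      refine ⟨y, ?_⟩
      rw [show alternatingRay Γ j i 0 = alternatingRay Γ i j 0 from rfl, hy,
        busemann_alternatingRay hij hadj, busemann_alternatingRay hij hadj]
      exact ⟨alternatingRay_mem_closure i j _, by norm_num⟩
    | succ n =>
      obtain ⟨y, hy⟩ := bwd n
      refine ⟨y, by rw [hy]; exact mem_closure_pair_iff.mpr ⟨n, .inr rfl⟩, ?_⟩
      rw [hy, busemann_alternatingRay_swap hij hadj, busemann_alternatingRay_swap hij hadj]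
      push_cast
      ring

/-- An element is connected on its horosphere to the element of the dihedral subgroup there, by
induction along a geodesic to the ray; each step lifts the path obtained one level below. -/
theorem horosphereConnected_of_mem_closure (hΓ : StandingAssumptions Γ) (hij : i ≠ j)
    (hadj : ¬ Γ.Adj i j) {v w : RACG Γ}
    (hv : v ∈ Subgroup.closure {racgGen Γ i, racgGen Γ j})
    (h : busemann (alternatingRay Γ i j) v = busemann (alternatingRay Γ i j) w) :
    HorosphereConnected (alternatingRay Γ i j) v w := by
  have hγ := isGeodesicRay_alternatingRay hij hadj
  induction w using busemann_induction hγ rfl generalizing v with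
  | ray n =>
    rw [eq_of_mem_closure_of_busemann_eq hij hadj hv (alternatingRay_mem_closure i j n) h]
  | up u x ih hu =>
    obtain ⟨y, hyv, hy⟩ := exists_descent_of_mem_closure hij hadj hv
    have hvy : v * racgGen Γ y * racgGen Γ y = v := by simp [mul_assoc]
    have key := horosphereConnected_of_horosphereConnected hΓ hγ rfl (ih hyv (by omega))
      (x := y) (y := x) (by rw [hvy]; omega) hu
    rwa [hvy] at key

end AlternatingRay

/-! ### Elements with empty suffix -/

section EmptySuffix

variable {V : Type*} {Γ : SimpleGraph V} {i j : V}

/-- In the action on the line, only the letters `i` and `j` move `0`, by at most one unit each,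
whereas an element of length `n` of the dihedral subgroup moves it by `n`. Hence a geodesic word for
such an element has no other letters. -/
theorem forall_mem_of_isGeodesicWord (hij : i ≠ j) (hadj : ¬ Γ.Adj i j) {l : List V}
    (hl : IsGeodesicWord Γ l)
    (hmem : spell Γ l ∈ Subgroup.closure {racgGen Γ i, racgGen Γ j}) :
    ∀ v ∈ l, v = i ∨ v = j := by
  classical
  obtain ⟨φ, hi, hj, hother⟩ := exists_lineAction (Γ := Γ) hij hadj
  have upper : ∀ l : List V, |φ (spell Γ l) 0| ≤ l.countP fun v => v = i ∨ v = j := by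
    intro l
    induction l with
    | nil => simp [spell]
    | cons v l ih =>
      rw [spell, CoxeterSystem.wordProd_cons, map_mul, Equiv.Perm.mul_apply, List.countP_cons]
      change |φ (racgGen Γ v) (φ (spell Γ l) 0)| ≤ _
      revert ih
      generalize φ (spell Γ l) 0 = a
      intro ih
      by_cases h1 : v = i
      · subst h1
        simp only [hi, true_or, decide_true, if_true]
        push_cast
        rw [abs_le] at ih ⊢
        omega
      · by_cases h2 : v = j
        · subst h2
          simp only [hj, or_true, decide_true, if_true]
          push_cast
          rw [abs_le] at ih ⊢
          omega
        · simpa [hother v h1 h2, h1, h2] using ih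
  have ray : ∀ n : ℕ, φ (alternatingRay Γ i j n) 0 = n ∧ φ (alternatingRay Γ j i n) 0 = -n := by
    intro n
    induction n with
    | zero => simp [alternatingRay]
    | succ n ih =>
      rw [alternatingRay_succ_left, alternatingRay_succ_left, map_mul, map_mul,
        Equiv.Perm.mul_apply, Equiv.Perm.mul_apply, ih.1, ih.2, hi, hj]
      push_cast
      constructor <;> ring
  have lower : |φ (spell Γ l) 0| = l.length := by
    rw [← hl]
    obtain ⟨n, hn | hn⟩ := mem_closure_pair_iff.mp hmem
    · rw [hn, (ray n).1, wordLength_alternatingRay hij hadj, Nat.abs_cast]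
    · rw [hn, (ray n).2, wordLength_alternatingRay hij.symm (fun h => hadj h.symm), abs_neg,
        Nat.abs_cast]
  have h := upper l
  rw [lower] at h
  have h' : l.countP (fun v => v = i ∨ v = j) = l.length :=
    le_antisymm List.countP_le_length (by exact_mod_cast h)
  simpa using List.countP_eq_length.mp h'

theorem spell_mem_closure {l : List V} (hl : ∀ v ∈ l, v = i ∨ v = j) :
    spell Γ l ∈ Subgroup.closure {racgGen Γ i, racgGen Γ j} := by
  refine list_prod_mem fun g hg => ?_
  obtain ⟨v, hv, rfl⟩ := List.mem_map.mp hg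
  rcases hl v hv with rfl | rfl <;> exact Subgroup.subset_closure (by simp)

theorem eq_nil_of_isRearrangement_nil {l : List V} (h : IsRearrangement Γ [] l) : l = [] := by
  induction h with
  | refl => rfl
  | tail _ hstep ih =>
    subst ih
    generalize hl : ([] : List V) = l' at hstep
    cases hstep
    simp at hl

variable [LinearOrder V]

theorem isShortlex_nil : IsShortlex Γ [] :=
  ⟨by simp [IsGeodesicWord, spell], fun l _ _ => not_lt.mp (List.not_lt_nil l)⟩

/-- The vertex set may be infinite, but an element of the dihedral subgroup has only finitely many
geodesic words, because their letters are `i` and `j`. -/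
theorem exists_isShortlex_spell_eq (hij : i ≠ j) (hadj : ¬ Γ.Adj i j) {g : RACG Γ}
    (hg : g ∈ Subgroup.closure {racgGen Γ i, racgGen Γ j}) :
    ∃ w, IsShortlex Γ w ∧ spell Γ w = g := by
  let S : Set (List V) := {l | IsGeodesicWord Γ l ∧ spell Γ l = g}
  have fin : S.Finite := by
    have : Finite {v : V // v = i ∨ v = j} := (Set.toFinite {i, j}).to_subtype
    refine ((List.finite_length_eq {v : V // v = i ∨ v = j} (wordLength g)).image
      (List.map Subtype.val)).subset ?_
    rintro l ⟨hl, rfl⟩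
    have hmem := forall_mem_of_isGeodesicWord hij hadj hl hg
    exact ⟨l.attachWith _ hmem, by simp [hl.symm], by simp⟩
  have ne : S.Nonempty := by
    obtain ⟨l, hl, hgl⟩ := (racgSystem Γ).exists_isReduced g
    exact ⟨l, hl, hgl.symm⟩
  obtain ⟨w, hw, hmin⟩ := Set.exists_min_image S id fin ne
  exact ⟨w, ⟨hw.1, fun l hl hlw => hmin l ⟨hl, hlw.trans hw.2⟩⟩, hw.2⟩

theorem hasEmptySuffix_iff (hij : i ≠ j) (hadj : ¬ Γ.Adj i j) {g : RACG Γ} :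
    HasEmptySuffix i j g ↔ g ∈ Subgroup.closure {racgGen Γ i, racgGen Γ j} := by
  constructor
  · rintro ⟨w, p, rfl, h⟩
    rw [← h.spell_eq, List.append_nil]
    exact spell_mem_closure h.prefix_letters
  · intro hg
    obtain ⟨w, hw, rfl⟩ := exists_isShortlex_spell_eq hij hadj hg
    refine ⟨w, w, rfl, hw, by rw [List.append_nil], by rw [List.append_nil]; exact hw.1,
      forall_mem_of_isGeodesicWord hij hadj hw.1 hg, isShortlex_nil, fun s hs => ?_⟩
    rw [eq_nil_of_isRearrangement_nil hs]
    simp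

end EmptySuffix

/-! ### Connectedness of the horospheres -/

theorem mainTheorem4 {V : Type*} [LinearOrder V] (Γ : SimpleGraph V)
    (hΓ : StandingAssumptions Γ) (i j : V) (hij : i ≠ j) (hadj : ¬ Γ.Adj i j) :
    (∀ k : ℤ, ∃! v : RACG Γ,
      v ∈ horosphere (alternatingRay Γ i j) k ∧ HasEmptySuffix i j v) ∧
    (∀ (w : RACG Γ) (v : horosphere (alternatingRay Γ i j) (busemann (alternatingRay Γ i j) w)),
      HasEmptySuffix i j (v : RACG Γ) →
        (ripsGraph 2
          (horosphere (alternatingRay Γ i j) (busemann (alternatingRay Γ i j) w))).Reachable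
            v ⟨w, rfl⟩) ∧
    ∀ k : ℤ, (ripsGraph 2 (horosphere (alternatingRay Γ i j) k)).Connected := by
  refine ⟨fun k => ?_, fun w v hv => ?_, fun k => ?_⟩
  · obtain ⟨v, hv, hvk⟩ := exists_mem_closure_busemann_eq hij hadj k
    refine ⟨v, ⟨hvk, (hasEmptySuffix_iff hij hadj).mpr hv⟩, fun w hw => ?_⟩
    exact eq_of_mem_closure_of_busemann_eq hij hadj ((hasEmptySuffix_iff hij hadj).mp hw.2) hv
      (hw.1.trans hvk.symm)
  · exact (horosphereConnected_of_mem_closure hΓ hij hadj ((hasEmptySuffix_iff hij hadj).mp hv)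
      v.2).reachable v.2 rfl
  · obtain ⟨v, hv, hvk⟩ := exists_mem_closure_busemann_eq hij hadj k
    have reach : ∀ w : horosphere (alternatingRay Γ i j) k,
        (ripsGraph 2 (horosphere (alternatingRay Γ i j) k)).Reachable ⟨v, hvk⟩ w := fun w =>
      (horosphereConnected_of_mem_closure hΓ hij hadj hv (hvk.trans w.2.symm)).reachable hvk w.2
    exact SimpleGraph.connected_iff_exists_forall_reachable _ |>.mpr ⟨⟨v, hvk⟩, reach⟩
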